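/- Let $H^2$ be the hyperbolic plane, realised as the projective (Klein) disk model. A polygon in $H^2$ is a set with non-empty interior that is the convex hull in $H^2$ of finitely many points, each lying in $H^2$ (actual vertices) or on the circle at infinity $\partial H^2$ (ideal vertices). It is right-angled if each of its interior angles is $\pi/2$ or $0$ (angle $0$ occurs exactly at the ideal vertices). Let $\Delta^2$ be the triangle whose vertices are represented in the hyperboloid model in $\mathbb{R}^{2,1}$ by $(1,0,1)$ (ideal), $(1,1,2)/\sqrt{2}$ and $(0,0,1)$, and let $P^2$ be the union of $\Delta^2$ and its mirror image in its finite side, that is, its image under $(x_1,x_2,x_3)\mapsto(x_2,x_1,x_3)$. Then $P^2$ is a right-angled triangle with one actual vertex, where the angle is $\pi/2$, and two ideal vertices; its hyperbolic area is $\pi/2$; and $$\mathrm{Area}(P^2)\le \mathrm{Area}(Q)$$ for every right-angled polygon $Q$ in $H^2$. -/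

import Mathlib

/-- The projective (Klein) disk model of the hyperbolic plane `H²`: the point `x` of the hyperboloid
`x₀² + x₁² - x₂² = -1`, `x₂ > 0`, corresponds to `(x₀ / x₂, x₁ / x₂)`.
Geodesics are open Euclidean chords. -/
def kleinDisk : Set (ℝ × ℝ) := {p | p.1 ^ 2 + p.2 ^ 2 < 1}

/-- The circle at infinity `∂H²`. -/
def idealCircle : Set (ℝ × ℝ) := {p | p.1 ^ 2 + p.2 ^ 2 = 1}

/-- Hyperbolic area in the projective disk model:
`dA = (1 - x² - y²) ^ (-3/2) dx dy` on the open unit disk. -/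
noncomputable def hyperbolicArea : MeasureTheory.Measure (ℝ × ℝ) :=
  (MeasureTheory.volume.restrict kleinDisk).withDensity fun p ↦
    ENNReal.ofReal (((1 - p.1 ^ 2 - p.2 ^ 2) ^ (3 / 2 : ℝ))⁻¹)

/-- The Lorentzian inner product of signature `(2, 1)` on `ℝ³`. -/
def lorentzInner (x y : Fin 3 → ℝ) : ℝ := x 0 * y 0 + x 1 * y 1 - x 2 * y 2

/-- Twice the signed Euclidean area of the triangle `p q r`; it is positive exactly when `r` lies
strictly to the left of the directed line from `p` to `q`. -/
def orientation (p q r : ℝ × ℝ) : ℝ :=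
  (q.1 - p.1) * (r.2 - p.2) - (q.2 - p.2) * (r.1 - p.1)

/-- The Lorentz normal vector of the hyperbolic line from `p` to `q`, pointing to its left: for
every `r`, `lorentzInner (lineNormal p q) ![r.1, r.2, 1] = orientation p q r`
(see `lorentzInner_lineNormal`). It is space-like when `p ≠ q` are in the closed disk. -/
def lineNormal (p q : ℝ × ℝ) : Fin 3 → ℝ :=
  ![-(q.2 - p.2), q.1 - p.1, -(p.1 * q.2 - p.2 * q.1)]

theorem lorentzInner_lineNormal (p q r : ℝ × ℝ) :
    lorentzInner (lineNormal p q) ![r.1, r.2, 1] = orientation p q r := by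
  simp [lorentzInner, lineNormal, orientation]
  ring

/-- The interior (dihedral) angle at `q` between the consecutive sides `p q` and `q r` of a polygon
that lies to the left of both: `π` minus the Lorentzian angle between the two inward normals, that
is, the number `θ ∈ [0, π]` with `cos θ = -⟨N, N'⟩ / (‖N‖ ‖N'‖)`. If `q` is an ideal point then
`⟨N, N'⟩ = -‖N‖ ‖N'‖`, and the angle is `0`. -/
noncomputable def dihedralAngle (p q r : ℝ × ℝ) : ℝ :=
  Real.arccos (-lorentzInner (lineNormal p q) (lineNormal q r) /
    (Real.sqrt (lorentzInner (lineNormal p q) (lineNormal p q)) *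
      Real.sqrt (lorentzInner (lineNormal q r) (lineNormal q r))))

/-- A (convex, two-dimensional) polygon in `H²` with `n ≥ 3` vertices, each of them actual (in `H²`)
or ideal (in `∂H²`). The vertices are listed counterclockwise, indices modulo `n`: all the
vertices other than the endpoints of a side lie strictly to the left of that side. -/
structure HyperbolicPolygon (n : ℕ) [NeZero n] where
  three_le : 3 ≤ n
  vertex : Fin n → ℝ × ℝ
  vertex_mem : ∀ i, vertex i ∈ kleinDisk ∪ idealCircle
  left_of_side : ∀ i j, j ≠ i → j ≠ i + 1 → 0 < orientation (vertex i) (vertex (i + 1)) (vertex j)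

/-- The point set of a polygon: the convex hull in `H²` of its actual and ideal vertices. -/
def HyperbolicPolygon.region {n : ℕ} [NeZero n] (P : HyperbolicPolygon n) : Set (ℝ × ℝ) :=
  convexHull ℝ (Set.range P.vertex) ∩ kleinDisk

/-- The interior angle at the `i`-th vertex, between the two sides that are adjacent there. -/
noncomputable def HyperbolicPolygon.angle {n : ℕ} [NeZero n] (P : HyperbolicPolygon n)
    (i : Fin n) : ℝ :=
  dihedralAngle (P.vertex (i - 1)) (P.vertex i) (P.vertex (i + 1))

/-- A polygon is right-angled if each of its angles is `0` or `π / 2`. -/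
def HyperbolicPolygon.IsRightAngled {n : ℕ} [NeZero n] (P : HyperbolicPolygon n) : Prop :=
  ∀ i, P.angle i = 0 ∨ P.angle i = Real.pi / 2

/-- The Coxeter triangle `Δ²`, with vertices `(1,0,1)`, `(1,1,2)/√2`, `(0,0,1)` in `ℝ^{2,1}`, in the
projective disk model. -/
def triangleDelta : Set (ℝ × ℝ) :=
  convexHull ℝ {((1, 0) : ℝ × ℝ), (1 / 2, 1 / 2), (0, 0)} ∩ kleinDisk

/-- `P²` is the union of `Δ²` and its mirror image in the finite side on the line `x = y`. -/
def polygonP2 : Set (ℝ × ℝ) := triangleDelta ∪ Prod.swap '' triangleDelta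

/-! The area of a right-angled polygon is an integral multiple of `π / 2`, and it is positive
because the polygon contains a non-empty open set. Hence it is at least `π / 2`, which is the area
of `P²`.

Integrality is a weak form of Gauss–Bonnet, obtained by integrating the density twice. In `y` it has
the primitive `slicePrimitive`; along a chord `y = a x + b`, that function of `x` has a primitive in
turn, and this primitive is an angle, `lineAngle` (`hasDerivAt_lineAngle`). A generic vertical line
that meets the polygon's interior crosses one side from right to left and one from left to right.
The area is therefore the sum over the sides of the angle at the start minus the angle at the end
(`hyperbolicArea_region`).

Regrouped by vertices, this is a sum of jumps between consecutive sides. At an actual vertex the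
jump is, up to sign and modulo `π`, the angle between the normals (`cos_edgeAngle_sub`), so right
angles give multiples of `π / 2`. At an ideal vertex each side's angle is itself such a multiple
(`edgeAngle_of_mem_idealCircle`). Since only the class modulo `π / 2` matters, no sign or winding
number has to be tracked. -/

section

open MeasureTheory Set Filter Topology

/-! ### The fundamental theorem of calculus off a finite set -/

theorem ftc_of_nonneg_off_finset (S : Finset ℝ) (H h : ℝ → ℝ) {a b : ℝ} (hab : a ≤ b)
    (hc : ContinuousOn H (Icc a b)) (hd : ∀ x ∈ Ioo a b, x ∉ S → HasDerivAt H (h x) x)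
    (hn : ∀ x ∈ Ioo a b, x ∉ S → 0 ≤ h x) :
    IntervalIntegrable h volume a b ∧ ∫ x in a..b, h x = H b - H a := by
  induction S using Finset.induction_on generalizing a b with
  | empty =>
    have hi : IntervalIntegrable h volume a b :=
      (intervalIntegrable_iff_integrableOn_Ioc_of_le hab).2
        (intervalIntegral.integrableOn_deriv_of_nonneg hc (fun x hx ↦ hd x hx (by simp))
          (fun x hx ↦ hn x hx (by simp)))
    exact ⟨hi, intervalIntegral.integral_eq_sub_of_hasDerivAt_of_le hab hc
      (fun x hx ↦ hd x hx (by simp)) hi⟩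
  | insert c S hcS ih =>
    by_cases hcab : c ∈ Ioo a b
    -- Cut at the exceptional point `c`: it is interior to neither half, so the induction hypothesis
    -- applies to both.
    · have key : ∀ a' b', a ≤ a' → b' ≤ b → a' ≤ b' → c ∉ Ioo a' b' →
          IntervalIntegrable h volume a' b' ∧ ∫ x in a'..b', h x = H b' - H a' := by
        intro a' b' h1 h2 h3 h4
        have hsub : Ioo a' b' ⊆ Ioo a b := Ioo_subset_Ioo h1 h2
        have hne : ∀ x ∈ Ioo a' b', x ∉ S → x ∉ insert c S := by
          intro x hx hxS
          rw [Finset.mem_insert, not_or]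
          exact ⟨fun e ↦ h4 (e ▸ hx), hxS⟩
        exact ih h3 (hc.mono (Icc_subset_Icc h1 h2))
          (fun x hx hxS ↦ hd x (hsub hx) (hne x hx hxS))
          (fun x hx hxS ↦ hn x (hsub hx) (hne x hx hxS))
      obtain ⟨i1, e1⟩ := key a c le_rfl hcab.2.le hcab.1.le (by simp)
      obtain ⟨i2, e2⟩ := key c b hcab.1.le le_rfl hcab.2.le (by simp)
      refine ⟨i1.trans i2, ?_⟩
      rw [← intervalIntegral.integral_add_adjacent_intervals i1 i2, e1, e2]
      ring
    · have hne : ∀ x ∈ Ioo a b, x ∉ S → x ∉ insert c S := by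
        intro x hx hxS
        rw [Finset.mem_insert, not_or]
        exact ⟨fun e ↦ hcab (e ▸ hx), hxS⟩
      exact ih hab hc (fun x hx hxS ↦ hd x hx (hne x hx hxS))
        (fun x hx hxS ↦ hn x hx (hne x hx hxS))

/-- The derivative may blow up at ideal vertices; its sign, together with continuity of `H`, is what
gives integrability. -/
theorem lintegral_eq_sub_of_nonneg_off_finset (S : Finset ℝ) (H h : ℝ → ℝ) {a b : ℝ} (hab : a ≤ b)
    (hc : ContinuousOn H (Icc a b)) (hd : ∀ x ∈ Ioo a b, x ∉ S → HasDerivAt H (h x) x)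
    (hn : ∀ x ∈ Ioo a b, x ∉ S → 0 ≤ h x) :
    ∫⁻ x in Ioo a b, ENNReal.ofReal (h x) = ENNReal.ofReal (H b - H a) := by
  obtain ⟨hi, he⟩ := ftc_of_nonneg_off_finset S H h hab hc hd hn
  rw [intervalIntegral.integral_of_le hab, integral_Ioc_eq_integral_Ioo] at he
  rw [← he]
  symm
  apply ofReal_integral_eq_lintegral_ofReal
  · exact ((intervalIntegrable_iff_integrableOn_Ioc_of_le hab).1 hi).mono_set Ioo_subset_Ioc_self
  · have hS : ∀ᵐ x ∂(volume.restrict (Ioo a b)), x ∉ (S : Set ℝ) :=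
      ae_restrict_of_ae (S.countable_toSet.ae_notMem volume)
    filter_upwards [hS, ae_restrict_mem measurableSet_Ioo] with x h1 h2
    exact hn x h2 h1

/-! ### Primitives of the area density along vertical lines and chords -/

/-- A primitive in `y` of the density `(1 - x² - y²) ^ (-3/2)` of hyperbolic area. -/
noncomputable def slicePrimitive (x y : ℝ) : ℝ := y / ((1 - x ^ 2) * √(1 - x ^ 2 - y ^ 2))

/-- The complement of the angle between the line `y = a x + b` and the vertical line at `x`. -/
noncomputable def lineAngle (a b x : ℝ) : ℝ :=
  Real.arcsin ((a + b * x) / (√(1 - x ^ 2) * √(1 + a ^ 2 - b ^ 2)))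

theorem rpow_three_halves {z : ℝ} (hz : 0 < z) : z ^ (3 / 2 : ℝ) = z * √z := by
  rw [show (3 / 2 : ℝ) = 1 + 1 / 2 by norm_num, Real.rpow_add hz, Real.rpow_one,
    Real.sqrt_eq_rpow]

theorem hasDerivAt_slicePrimitive {x y : ℝ} (h : x ^ 2 + y ^ 2 < 1) :
    HasDerivAt (slicePrimitive x) (((1 - x ^ 2 - y ^ 2) ^ (3 / 2 : ℝ))⁻¹) y := by
  have hz : 0 < 1 - x ^ 2 - y ^ 2 := by linarith
  have hx : 0 < 1 - x ^ 2 := by nlinarith [sq_nonneg y]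
  have hs : 0 < √(1 - x ^ 2 - y ^ 2) := Real.sqrt_pos.2 hz
  have h1 : HasDerivAt (fun y ↦ 1 - x ^ 2 - y ^ 2) (-(2 * y)) y := by
    simpa using ((hasDerivAt_pow 2 y).const_sub (1 - x ^ 2))
  have h2 := (h1.sqrt hz.ne').const_mul (1 - x ^ 2)
  have h3 := (hasDerivAt_id y).div h2 (mul_pos hx hs).ne'
  refine h3.congr_deriv ?_
  rw [rpow_three_halves hz]
  have hsq := Real.sq_sqrt hz.le
  set s := √(1 - x ^ 2 - y ^ 2)
  rw [← hsq]
  simp only [id]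
  field_simp
  rw [hsq]; ring

theorem lintegral_slice {x l u : ℝ} (hlu : l ≤ u) (hl : x ^ 2 + l ^ 2 < 1)
    (hu : x ^ 2 + u ^ 2 < 1) :
    ∫⁻ y in Icc l u, ENNReal.ofReal (((1 - x ^ 2 - y ^ 2) ^ (3 / 2 : ℝ))⁻¹) =
      ENNReal.ofReal (slicePrimitive x u - slicePrimitive x l) := by
  have hin : ∀ y ∈ Icc l u, x ^ 2 + y ^ 2 < 1 := by
    intro y hy
    rcases le_total 0 y with h | h
    · nlinarith [hy.2]
    · nlinarith [hy.1]
  rw [← lintegral_eq_sub_of_nonneg_off_finset ∅ (slicePrimitive x)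
    (fun y ↦ ((1 - x ^ 2 - y ^ 2) ^ (3 / 2 : ℝ))⁻¹) hlu
    (fun y hy ↦ (hasDerivAt_slicePrimitive (hin y hy)).continuousAt.continuousWithinAt)
    (fun y hy _ ↦ hasDerivAt_slicePrimitive (hin y (Ioo_subset_Icc_self hy)))
    (fun y hy _ ↦ inv_nonneg.2 (Real.rpow_nonneg
      (by linarith [hin y (Ioo_subset_Icc_self hy)]) _))]
  exact setLIntegral_congr Ioo_ae_eq_Icc.symm

/-- The relation `sin² + cos² = 1` for `lineAngle`, with denominators cleared. On the circle at
infinity the last term vanishes, so the cosine does too. -/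
theorem normSq_line_mul (a b x : ℝ) :
    (1 - x ^ 2) * (1 + a ^ 2 - b ^ 2) = (a + b * x) ^ 2 + (1 - x ^ 2 - (a * x + b) ^ 2) := by
  ring

theorem normSq_line_pos {a b x : ℝ} (h : x ^ 2 + (a * x + b) ^ 2 < 1) :
    0 < 1 + a ^ 2 - b ^ 2 := by
  have hx : 0 < 1 - x ^ 2 := by nlinarith [sq_nonneg (a * x + b)]
  refine pos_of_mul_pos_right (b := 1 + a ^ 2 - b ^ 2) (a := 1 - x ^ 2) ?_ hx.le
  rw [normSq_line_mul]
  nlinarith [sq_nonneg (a + b * x)]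

theorem one_sub_sq_sin_lineAngle {a b x : ℝ} (h : x ^ 2 + (a * x + b) ^ 2 < 1) :
    1 - ((a + b * x) / (√(1 - x ^ 2) * √(1 + a ^ 2 - b ^ 2))) ^ 2 =
      (√(1 - x ^ 2 - (a * x + b) ^ 2) / (√(1 - x ^ 2) * √(1 + a ^ 2 - b ^ 2))) ^ 2 := by
  have hx : 0 < 1 - x ^ 2 := by nlinarith [sq_nonneg (a * x + b)]
  have hc := normSq_line_pos h
  rw [div_pow, div_pow, mul_pow, Real.sq_sqrt hx.le, Real.sq_sqrt hc.le,
    Real.sq_sqrt (by linarith : 0 ≤ 1 - x ^ 2 - (a * x + b) ^ 2)]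
  rw [eq_div_iff (mul_pos hx hc).ne', sub_mul, div_mul_cancel₀ _ (mul_pos hx hc).ne']
  ring

theorem cos_lineAngle {a b x : ℝ} (h : x ^ 2 + (a * x + b) ^ 2 < 1) :
    Real.cos (lineAngle a b x) =
      √(1 - x ^ 2 - (a * x + b) ^ 2) / (√(1 - x ^ 2) * √(1 + a ^ 2 - b ^ 2)) := by
  rw [lineAngle, Real.cos_arcsin, one_sub_sq_sin_lineAngle h, Real.sqrt_sq (by positivity)]

theorem sin_lineAngle {a b x : ℝ} (h : x ^ 2 + (a * x + b) ^ 2 < 1) :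
    Real.sin (lineAngle a b x) = (a + b * x) / (√(1 - x ^ 2) * √(1 + a ^ 2 - b ^ 2)) := by
  have h1 := one_sub_sq_sin_lineAngle h
  have h2 := abs_le.1 ((sq_le_one_iff_abs_le_one ((a + b * x) /
    (√(1 - x ^ 2) * √(1 + a ^ 2 - b ^ 2)))).1 (by
      linarith [sq_nonneg (√(1 - x ^ 2 - (a * x + b) ^ 2) /
        (√(1 - x ^ 2) * √(1 + a ^ 2 - b ^ 2)))]))
  rw [lineAngle, Real.sin_arcsin h2.1 h2.2]

/-- The derivative of `(a + b x) / √(1 - x²)` is `(a x + b) / (1 - x²) ^ (3/2)`, so the height of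
the chord appears in the numerator; dividing by the cosine of the angle gives `slicePrimitive`. -/
theorem hasDerivAt_lineAngle {a b x : ℝ} (h : x ^ 2 + (a * x + b) ^ 2 < 1) :
    HasDerivAt (lineAngle a b) (slicePrimitive x (a * x + b)) x := by
  have hx : 0 < 1 - x ^ 2 := by nlinarith [sq_nonneg (a * x + b)]
  have hc := normSq_line_pos h
  have hz : 0 < 1 - x ^ 2 - (a * x + b) ^ 2 := by linarith
  have hS : 0 < √(1 - x ^ 2) := Real.sqrt_pos.2 hx
  have hC : 0 < √(1 + a ^ 2 - b ^ 2) := Real.sqrt_pos.2 hc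
  have hR : 0 < √(1 - x ^ 2 - (a * x + b) ^ 2) := Real.sqrt_pos.2 hz
  have h0 := one_sub_sq_sin_lineAngle h
  have hne : (a + b * x) / (√(1 - x ^ 2) * √(1 + a ^ 2 - b ^ 2)) ≠ -1 ∧
      (a + b * x) / (√(1 - x ^ 2) * √(1 + a ^ 2 - b ^ 2)) ≠ 1 := by
    have : 0 < (√(1 - x ^ 2 - (a * x + b) ^ 2) / (√(1 - x ^ 2) * √(1 + a ^ 2 - b ^ 2))) ^ 2 := by
      positivity
    constructor <;> intro e <;> rw [e] at h0 <;> norm_num at h0 <;> grind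
  have h1 : HasDerivAt (fun x : ℝ ↦ 1 - x ^ 2) (-(2 * x)) x := by
    simpa using ((hasDerivAt_pow 2 x).const_sub 1)
  have h2 := (h1.sqrt hx.ne').mul_const (√(1 + a ^ 2 - b ^ 2))
  have h3 : HasDerivAt (fun x : ℝ ↦ a + b * x) b x := by
    simpa using ((hasDerivAt_id x).const_mul b).const_add a
  have h4 := h3.div h2 (mul_pos hS hC).ne'
  have h5 := (Real.hasDerivAt_arcsin hne.1 hne.2).comp x h4
  refine h5.congr_deriv ?_
  rw [h0, Real.sqrt_sq (by positivity), slicePrimitive]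
  have hsq := Real.sq_sqrt hx.le
  set s := √(1 - x ^ 2)
  field_simp
  have : 1 - x ^ 2 = s ^ 2 := hsq.symm
  rw [this]
  field_simp
  rw [hsq]; ring

theorem continuousOn_lineAngle {a b l u : ℝ} (hl : -1 ≤ l) (hu : u ≤ 1)
    (hl' : l = -1 → a - b = 0) (hu' : u = 1 → a + b = 0) (hc : 0 < 1 + a ^ 2 - b ^ 2) :
    ContinuousOn (lineAngle a b) (Icc l u) := by
  have hC : 0 < √(1 + a ^ 2 - b ^ 2) := Real.sqrt_pos.2 hc
  have key : ContinuousOn (fun x ↦ (a + b * x) / √(1 - x ^ 2)) (Icc l u) := by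
    intro x hx
    rcases eq_or_lt_of_le (hx.2.trans hu) with h1 | h1
    -- At `x = 1` the quotient is `0 / 0`. Cancelling `√(1 - x)` gives a continuous expression with
    -- value `0` there, which agrees with the convention for division by zero.
    · have hb : b = -a := by linarith [hu' (le_antisymm hu (h1 ▸ hx.2))]
      have hc' : ContinuousWithinAt (fun x ↦ a * (√(1 - x) / √(1 + x))) (Icc l u) x := by
        apply ContinuousAt.continuousWithinAt
        have : √(1 + x) ≠ 0 := (Real.sqrt_pos.2 (by linarith)).ne'
        fun_prop (disch := assumption)
      have he : ∀ z ∈ Icc l u, (a + b * z) / √(1 - z ^ 2) = a * (√(1 - z) / √(1 + z)) := by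
        intro z hz
        rw [show 1 - z ^ 2 = (1 - z) * (1 + z) by ring,
          Real.sqrt_mul (by linarith [hz.2]), hb, show a + -a * z = a * (1 - z) by ring,
          mul_div_assoc, ← div_div, Real.div_sqrt]
      exact hc'.congr he (he x hx)
    · rcases eq_or_lt_of_le (hl.trans hx.1) with h2 | h2
      · have hb : b = a := by linarith [hl' (le_antisymm (h2 ▸ hx.1) hl)]
        have hc' : ContinuousWithinAt (fun x ↦ a * (√(1 + x) / √(1 - x))) (Icc l u) x := by
          apply ContinuousAt.continuousWithinAt
          have : √(1 - x) ≠ 0 := (Real.sqrt_pos.2 (by linarith)).ne'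
          fun_prop (disch := assumption)
        have he : ∀ z ∈ Icc l u, (a + b * z) / √(1 - z ^ 2) = a * (√(1 + z) / √(1 - z)) := by
          intro z hz
          rw [show 1 - z ^ 2 = (1 + z) * (1 - z) by ring,
            Real.sqrt_mul (by linarith [hz.1]), hb, show a + a * z = a * (1 + z) by ring,
            mul_div_assoc, ← div_div, Real.div_sqrt]
        exact hc'.congr he (he x hx)
      · apply ContinuousAt.continuousWithinAt
        have : √(1 - x ^ 2) ≠ 0 := (Real.sqrt_pos.2 (by nlinarith)).ne'
        fun_prop (disch := assumption)
  have := Real.continuous_arcsin.comp_continuousOn (key.div_const (√(1 + a ^ 2 - b ^ 2)))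
  refine this.congr fun x _ ↦ ?_
  simp [lineAngle, div_div]

/-! ### The contribution of a single side -/

/-- Clamping the argument freezes a side's primitive outside its projection to the `x`-axis, so that
the primitives of all sides can be added on one common interval. -/
theorem continuous_clamp_comp {f : ℝ → ℝ} {l u : ℝ} (hlu : l ≤ u) (hf : ContinuousOn f (Icc l u)) :
    Continuous fun x ↦ f (max l (min u x)) :=
  hf.comp_continuous (by fun_prop) fun x ↦ ⟨le_max_left _ _, max_le hlu (min_le_left _ _)⟩

theorem hasDerivAt_clamp_comp {f : ℝ → ℝ} {l u x d : ℝ} (hlu : l ≤ u) (hl : x ≠ l) (hu : x ≠ u)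
    (hf : l < x → x < u → HasDerivAt f d x) :
    HasDerivAt (fun x ↦ f (max l (min u x))) (if l < x ∧ x < u then d else 0) x := by
  rcases lt_or_gt_of_ne hl with h | h
  · rw [if_neg (by grind)]
    refine (hasDerivAt_const x (f l)).congr_of_eventuallyEq ?_
    filter_upwards [Iio_mem_nhds h] with z hz
    rw [max_eq_left ((min_le_right _ _).trans (mem_Iio.1 hz).le)]
  · rcases lt_or_gt_of_ne hu with h' | h'
    · rw [if_pos ⟨h, h'⟩]
      refine (hf h h').congr_of_eventuallyEq ?_
      filter_upwards [Ioo_mem_nhds h h'] with z hz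
      rw [min_eq_right hz.2.le, max_eq_right hz.1.le]
    · rw [if_neg (by grind)]
      refine (hasDerivAt_const x (f u)).congr_of_eventuallyEq ?_
      filter_upwards [Ioi_mem_nhds h'] with z hz
      rw [min_eq_left (mem_Ioi.1 hz).le, max_eq_right hlu]

noncomputable def edgeSlope (p q : ℝ × ℝ) : ℝ := (q.2 - p.2) / (q.1 - p.1)

noncomputable def edgeIntercept (p q : ℝ × ℝ) : ℝ := p.2 - edgeSlope p q * p.1

/-- The height at `x` of the line through `p` and `q`. -/
noncomputable def edgeHeight (p q : ℝ × ℝ) (x : ℝ) : ℝ := edgeSlope p q * x + edgeIntercept p q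

/-- The angle at `x` between the line through `p` and `q` and the curve orthogonal to the vertical
lines. -/
noncomputable def edgeAngle (p q : ℝ × ℝ) (x : ℝ) : ℝ :=
  if p.1 = q.1 then Real.pi / 2 else lineAngle (edgeSlope p q) (edgeIntercept p q) x

theorem edgeHeight_left (p q : ℝ × ℝ) : edgeHeight p q p.1 = p.2 := by
  simp [edgeHeight, edgeIntercept]

theorem edgeHeight_right {p q : ℝ × ℝ} (h : p.1 ≠ q.1) : edgeHeight p q q.1 = q.2 := by
  have : q.1 - p.1 ≠ 0 := sub_ne_zero.2 h.symm
  simp only [edgeHeight, edgeIntercept, edgeSlope]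
  field_simp; ring

theorem orientation_eq_mul_sub_edgeHeight {p q : ℝ × ℝ} (h : p.1 ≠ q.1) (x y : ℝ) :
    orientation p q (x, y) = (q.1 - p.1) * (y - edgeHeight p q x) := by
  have : q.1 - p.1 ≠ 0 := sub_ne_zero.2 h.symm
  simp only [edgeHeight, edgeIntercept, edgeSlope, orientation]
  field_simp; ring

theorem orientation_combo (p q a b : ℝ × ℝ) (s t : ℝ) (h : s + t = 1) :
    orientation p q (s • a + t • b) = s * orientation p q a + t * orientation p q b := by
  obtain rfl : s = 1 - t := by linarith
  simp [orientation]; ring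

theorem normSq_combo_lt_one {p q : ℝ × ℝ} (hp : p.1 ^ 2 + p.2 ^ 2 ≤ 1) (hq : q.1 ^ 2 + q.2 ^ 2 ≤ 1)
    (hpq : p ≠ q) {s t : ℝ} (hs : 0 < s) (ht : 0 < t) (h : s + t = 1) :
    (s • p + t • q).1 ^ 2 + (s • p + t • q).2 ^ 2 < 1 := by
  have h0 : 0 < (p.1 - q.1) ^ 2 + (p.2 - q.2) ^ 2 := by
    by_contra hn
    apply hpq
    ext <;> nlinarith [sq_nonneg (p.1 - q.1), sq_nonneg (p.2 - q.2)]
  obtain rfl : s = 1 - t := by linarith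
  simp only [Prod.fst_add, Prod.smul_fst, smul_eq_mul, Prod.snd_add, Prod.smul_snd]
  have := mul_pos (mul_pos hs ht) h0
  nlinarith [mul_le_mul_of_nonneg_left hp hs.le, mul_le_mul_of_nonneg_left hq ht.le]

theorem exists_edge_combo {p q : ℝ × ℝ} {x : ℝ} (h : p.1 < x ∧ x < q.1 ∨ q.1 < x ∧ x < p.1) :
    ∃ s t : ℝ, 0 < s ∧ 0 < t ∧ s + t = 1 ∧ s • p + t • q = (x, edgeHeight p q x) := by
  have hne : q.1 - p.1 ≠ 0 := by rcases h with h | h <;> intro e <;> linarith [h.1, h.2]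
  refine ⟨(q.1 - x) / (q.1 - p.1), (x - p.1) / (q.1 - p.1), ?_, ?_, ?_, ?_⟩
  · rcases h with h | h
    · exact div_pos (by linarith) (by linarith)
    · exact div_pos_of_neg_of_neg (by linarith) (by linarith)
  · rcases h with h | h
    · exact div_pos (by linarith) (by linarith)
    · exact div_pos_of_neg_of_neg (by linarith) (by linarith)
  · field_simp; ring
  · ext
    · simp; field_simp; ring
    · simp [edgeHeight, edgeIntercept, edgeSlope]; field_simp; ring

theorem edgeHeight_mem_kleinDisk {p q : ℝ × ℝ} (hp : p.1 ^ 2 + p.2 ^ 2 ≤ 1)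
    (hq : q.1 ^ 2 + q.2 ^ 2 ≤ 1) {x : ℝ} (h : p.1 < x ∧ x < q.1 ∨ q.1 < x ∧ x < p.1) :
    x ^ 2 + edgeHeight p q x ^ 2 < 1 := by
  obtain ⟨s, t, hs, ht, hst, he⟩ := exists_edge_combo h
  have hpq : p ≠ q := by rintro rfl; grind
  simpa [he] using normSq_combo_lt_one hp hq hpq hs ht hst

theorem normSq_edge_pos {p q : ℝ × ℝ} (hp : p.1 ^ 2 + p.2 ^ 2 ≤ 1)
    (hq : q.1 ^ 2 + q.2 ^ 2 ≤ 1) (h : p.1 ≠ q.1) :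
    0 < 1 + edgeSlope p q ^ 2 - edgeIntercept p q ^ 2 :=
  normSq_line_pos (x := (p.1 + q.1) / 2) (edgeHeight_mem_kleinDisk hp hq (by
    rcases lt_or_gt_of_ne h with h | h
    · left; constructor <;> linarith
    · right; constructor <;> linarith))

theorem edgeSlope_comm (p q : ℝ × ℝ) : edgeSlope p q = edgeSlope q p := by
  rw [edgeSlope, edgeSlope, ← neg_sub q.2, ← neg_sub q.1, neg_div_neg_eq]

theorem edgeIntercept_comm {p q : ℝ × ℝ} (h : p.1 ≠ q.1) :
    edgeIntercept p q = edgeIntercept q p := by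
  have := edgeHeight_right h
  rw [edgeHeight] at this
  rw [edgeIntercept.eq_def q p, ← edgeSlope_comm p q]
  linarith

theorem abs_le_one_of_normSq {p : ℝ × ℝ} (hp : p.1 ^ 2 + p.2 ^ 2 ≤ 1) : -1 ≤ p.1 ∧ p.1 ≤ 1 := by
  constructor <;> nlinarith [sq_nonneg p.2]

theorem continuousOn_lineAngle_edge {p q : ℝ × ℝ} (hp : p.1 ^ 2 + p.2 ^ 2 ≤ 1)
    (hq : q.1 ^ 2 + q.2 ^ 2 ≤ 1) (h : p.1 < q.1) :
    ContinuousOn (lineAngle (edgeSlope p q) (edgeIntercept p q)) (Icc p.1 q.1) := by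
  have h1 := edgeHeight_left p q
  have h2 := edgeHeight_right h.ne
  rw [edgeHeight] at h1 h2
  refine continuousOn_lineAngle (abs_le_one_of_normSq hp).1 (abs_le_one_of_normSq hq).2 ?_ ?_
    (normSq_edge_pos hp hq h.ne)
  · intro e
    have : p.2 = 0 := by rw [e] at hp; nlinarith
    rw [e, this] at h1; linarith
  · intro e
    have : q.2 = 0 := by rw [e] at hq; nlinarith
    rw [e, this] at h2; linarith

/-- The part of a polygon's area to the left of `x` that its side from `p` to `q` accounts for, up
to an additive constant. -/
noncomputable def edgePrimitive (p q : ℝ × ℝ) (x : ℝ) : ℝ :=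
  if q.1 < p.1 then lineAngle (edgeSlope p q) (edgeIntercept p q) (max q.1 (min p.1 x))
  else if p.1 < q.1 then -lineAngle (edgeSlope p q) (edgeIntercept p q) (max p.1 (min q.1 x))
  else 0

noncomputable def edgeRate (p q : ℝ × ℝ) (x : ℝ) : ℝ :=
  if q.1 < x ∧ x < p.1 then slicePrimitive x (edgeHeight p q x)
  else if p.1 < x ∧ x < q.1 then -slicePrimitive x (edgeHeight p q x)
  else 0

theorem continuous_edgePrimitive {p q : ℝ × ℝ} (hp : p.1 ^ 2 + p.2 ^ 2 ≤ 1)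
    (hq : q.1 ^ 2 + q.2 ^ 2 ≤ 1) : Continuous (edgePrimitive p q) := by
  unfold edgePrimitive
  split_ifs with h1 h2
  · refine continuous_clamp_comp h1.le ?_
    rw [edgeSlope_comm, edgeIntercept_comm h1.ne']
    exact continuousOn_lineAngle_edge hq hp h1
  · exact (continuous_clamp_comp h2.le (continuousOn_lineAngle_edge hp hq h2)).neg
  · exact continuous_const

theorem hasDerivAt_edgePrimitive {p q : ℝ × ℝ} (hp : p.1 ^ 2 + p.2 ^ 2 ≤ 1)
    (hq : q.1 ^ 2 + q.2 ^ 2 ≤ 1) {x : ℝ} (hxp : x ≠ p.1) (hxq : x ≠ q.1) :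
    HasDerivAt (edgePrimitive p q) (edgeRate p q x) x := by
  unfold edgePrimitive edgeRate
  rcases lt_trichotomy p.1 q.1 with h | h | h
  · simp only [if_neg h.not_gt, if_pos h]
    rw [if_neg (by rintro ⟨h1, h2⟩; linarith)]
    refine HasDerivAt.congr_deriv (hasDerivAt_clamp_comp (d := slicePrimitive x (edgeHeight p q x)) h.le hxp hxq
      (f := lineAngle (edgeSlope p q) (edgeIntercept p q)) fun h1 h2 ↦
        hasDerivAt_lineAngle (edgeHeight_mem_kleinDisk hp hq (Or.inl ⟨h1, h2⟩))).neg ?_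
    · split_ifs <;> simp
  · simp only [h, lt_irrefl, if_false]
    rw [if_neg (by rintro ⟨h1, h2⟩; linarith), if_neg (by rintro ⟨h1, h2⟩; linarith)]
    exact hasDerivAt_const x (0 : ℝ)
  · simp only [if_pos h]
    rw [if_neg (c := p.1 < x ∧ x < q.1) (by rintro ⟨h1, h2⟩; linarith)]
    exact hasDerivAt_clamp_comp h.le hxq hxp fun h1 h2 ↦
      hasDerivAt_lineAngle (edgeHeight_mem_kleinDisk hp hq (Or.inr ⟨h1, h2⟩))

/-- The sign in `edgePrimitive` makes upper and lower sides obey the same formula; for a vertical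
side the constant angle cancels. -/
theorem edgePrimitive_one_sub {p q : ℝ × ℝ} (hp : p.1 ^ 2 + p.2 ^ 2 ≤ 1)
    (hq : q.1 ^ 2 + q.2 ^ 2 ≤ 1) :
    edgePrimitive p q 1 - edgePrimitive p q (-1) = edgeAngle p q p.1 - edgeAngle p q q.1 := by
  obtain ⟨h1, h2⟩ := abs_le_one_of_normSq hp
  obtain ⟨h3, h4⟩ := abs_le_one_of_normSq hq
  unfold edgePrimitive edgeAngle
  rcases lt_trichotomy p.1 q.1 with h | h | h
  · simp only [if_neg h.not_gt, if_pos h, if_neg h.ne, min_eq_left h4, min_eq_right h3,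
      max_eq_left h1, max_eq_right h.le]
    ring
  · simp [h]
  · simp only [if_pos h, if_neg h.ne', min_eq_left h2, min_eq_right h1, max_eq_left h3,
      max_eq_right h.le]

/-! ### Sides crossing a vertical line -/

open Fin.NatCast in
theorem Fin.exists_not_add_one {n : ℕ} [NeZero n] (A : Fin n → Prop) {i j : Fin n} (hi : A i)
    (hj : ¬ A j) : ∃ k, A k ∧ ¬ A (k + 1) := by
  by_contra! hn
  have key : ∀ m : ℕ, A (i + (m : Fin n)) := by
    intro m
    induction m with
    | zero => simpa using hi
    | succ m ih => have := hn _ ih; rwa [add_assoc, ← Nat.cast_add_one] at this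
  apply hj
  have := key (j - i).val
  rwa [Fin.cast_val_eq_self, add_sub_cancel] at this

namespace HyperbolicPolygon

variable {n : ℕ} [NeZero n] (P : HyperbolicPolygon n)

theorem normSq_vertex_le (i : Fin n) : (P.vertex i).1 ^ 2 + (P.vertex i).2 ^ 2 ≤ 1 := by
  rcases P.vertex_mem i with h | h
  · exact le_of_lt h
  · exact le_of_eq h

theorem _root_.Fin.add_one_ne (hn : 3 ≤ n) (i : Fin n) : i + 1 ≠ i := by
  intro h
  have h1 : (1 : Fin n) = 0 := by simpa using h
  have := congrArg Fin.val h1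
  rw [Fin.val_one', Fin.val_zero, Nat.mod_eq_of_lt (by omega)] at this
  omega

theorem _root_.Fin.add_one_add_one_ne (hn : 3 ≤ n) (i : Fin n) : i + 1 + 1 ≠ i := by
  intro h
  have h1 : (1 : Fin n) + 1 = 0 := by
    rw [add_assoc] at h
    simpa using h
  have := congrArg Fin.val h1
  rw [Fin.val_add, Fin.val_one', Fin.val_zero, Nat.mod_eq_of_lt (a := 1) (by omega),
    Nat.mod_eq_of_lt (by omega)] at this
  omega

theorem orientation_add_two_pos (i : Fin n) :
    0 < orientation (P.vertex i) (P.vertex (i + 1)) (P.vertex (i + 1 + 1)) :=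
  P.left_of_side i _ (Fin.add_one_add_one_ne P.three_le i)
    (Fin.add_one_ne P.three_le _)

theorem vertex_ne (i : Fin n) : P.vertex i ≠ P.vertex (i + 1) := by
  intro h
  have := P.orientation_add_two_pos i
  simp [orientation, h] at this

theorem orientation_nonneg (i j : Fin n) :
    0 ≤ orientation (P.vertex i) (P.vertex (i + 1)) (P.vertex j) := by
  by_cases h1 : j = i
  · subst h1; simp [orientation]
  by_cases h2 : j = i + 1
  · subst h2; simp only [orientation]; linarith
  exact (P.left_of_side i j h1 h2).le

theorem orientation_nonneg_of_mem_hull (i : Fin n) {r : ℝ × ℝ}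
    (hr : r ∈ convexHull ℝ (range P.vertex)) :
    0 ≤ orientation (P.vertex i) (P.vertex (i + 1)) r := by
  refine convexHull_min (t := {r | 0 ≤ orientation (P.vertex i) (P.vertex (i + 1)) r}) ?_ ?_ hr
  · rintro _ ⟨j, rfl⟩; exact P.orientation_nonneg i j
  · intro a ha b hb s t hs ht hst
    simp only [mem_ofPred_eq] at ha hb ⊢
    rw [orientation_combo _ _ _ _ _ _ hst]
    positivity

/-- At least one endpoint of the `j`-th side is off the line of the `i`-th side, and it has positive
weight. -/
theorem orientation_combo_pos {i j : Fin n} (hij : i ≠ j) {s t : ℝ} (hs : 0 < s) (ht : 0 < t)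
    (hst : s + t = 1) : 0 < orientation (P.vertex i) (P.vertex (i + 1))
      (s • P.vertex j + t • P.vertex (j + 1)) := by
  rw [orientation_combo _ _ _ _ _ _ hst]
  by_cases h : j = i + 1
  · subst h
    exact add_pos_of_nonneg_of_pos (mul_nonneg hs.le (P.orientation_nonneg _ _))
      (mul_pos ht (P.orientation_add_two_pos i))
  · exact add_pos_of_pos_of_nonneg (mul_pos hs (P.left_of_side i j hij.symm h))
      (mul_nonneg ht.le (P.orientation_nonneg _ _))

/-- The height at `x` of the line that contains the `i`-th side. -/
noncomputable def height (i : Fin n) (x : ℝ) : ℝ := edgeHeight (P.vertex i) (P.vertex (i + 1)) x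

/-- The interior of the `i`-th side crosses the vertical line at `x`, from right to left. -/
def IsUpper (i : Fin n) (x : ℝ) : Prop := (P.vertex (i + 1)).1 < x ∧ x < (P.vertex i).1

/-- The interior of the `i`-th side crosses the vertical line at `x`, from left to right. -/
def IsLower (i : Fin n) (x : ℝ) : Prop := (P.vertex i).1 < x ∧ x < (P.vertex (i + 1)).1

variable {P} {i j : Fin n} {x y : ℝ}

theorem IsUpper.le_height (h : P.IsUpper i x) (hy : (x, y) ∈ convexHull ℝ (range P.vertex)) :
    y ≤ P.height i x := by
  have := P.orientation_nonneg_of_mem_hull i hy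
  have hlt := h.1.trans h.2
  rw [orientation_eq_mul_sub_edgeHeight hlt.ne'] at this
  rw [height]; nlinarith

theorem IsLower.height_le (h : P.IsLower i x) (hy : (x, y) ∈ convexHull ℝ (range P.vertex)) :
    P.height i x ≤ y := by
  have := P.orientation_nonneg_of_mem_hull i hy
  have hlt := h.1.trans h.2
  rw [orientation_eq_mul_sub_edgeHeight hlt.ne] at this
  rw [height]; nlinarith

theorem IsUpper.height_lt (h : P.IsUpper i x) (hij : i ≠ j) (hj : P.IsLower j x ∨ P.IsUpper j x) :
    P.height j x < P.height i x := by
  obtain ⟨s, t, hs, ht, hst, he⟩ := exists_edge_combo hj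
  have := P.orientation_combo_pos hij hs ht hst
  have hlt := h.1.trans h.2
  rw [he, orientation_eq_mul_sub_edgeHeight hlt.ne'] at this
  rw [height, height]; nlinarith

theorem IsLower.lt_height (h : P.IsLower i x) (hij : i ≠ j) (hj : P.IsLower j x ∨ P.IsUpper j x) :
    P.height i x < P.height j x := by
  obtain ⟨s, t, hs, ht, hst, he⟩ := exists_edge_combo hj
  have := P.orientation_combo_pos hij hs ht hst
  have hlt := h.1.trans h.2
  rw [he, orientation_eq_mul_sub_edgeHeight hlt.ne] at this
  rw [height, height]; nlinarith

/-- Of two distinct upper sides, each would be strictly above the other. -/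
theorem IsUpper.unique (h : P.IsUpper i x) (h' : P.IsUpper j x) : i = j := by
  by_contra hij
  exact lt_asymm (h.height_lt hij (Or.inr h')) (h'.height_lt (Ne.symm hij) (Or.inr h))

theorem IsLower.unique (h : P.IsLower i x) (h' : P.IsLower j x) : i = j := by
  by_contra hij
  exact lt_asymm (h.lt_height hij (Or.inl h')) (h'.lt_height (Ne.symm hij) (Or.inl h))

theorem IsUpper.not_isLower (h : P.IsUpper i x) : ¬ P.IsLower i x := fun h' ↦
  lt_asymm (h.1.trans h.2) (h'.1.trans h'.2)

theorem height_mem (h : P.IsLower i x ∨ P.IsUpper i x) :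
    (x, P.height i x) ∈ convexHull ℝ (range P.vertex) := by
  obtain ⟨s, t, hs, ht, hst, he⟩ := exists_edge_combo h
  rw [height, ← he]
  exact convex_convexHull ℝ _ (subset_convexHull ℝ _ (mem_range_self i))
    (subset_convexHull ℝ _ (mem_range_self (i + 1))) hs.le ht.le hst

theorem height_mem_kleinDisk (h : P.IsLower i x ∨ P.IsUpper i x) :
    x ^ 2 + P.height i x ^ 2 < 1 :=
  edgeHeight_mem_kleinDisk (P.normSq_vertex_le _) (P.normSq_vertex_le _) h

variable (P)

theorem exists_crossing (hx : ∀ i, x ≠ (P.vertex i).1) (hi : (P.vertex i).1 < x)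
    (hj : x < (P.vertex j).1) : (∃ k, P.IsUpper k x) ∧ ∃ k, P.IsLower k x := by
  constructor
  · obtain ⟨k, h1, h2⟩ := Fin.exists_not_add_one (fun k ↦ x < (P.vertex k).1) hj hi.not_gt
    exact ⟨k, lt_of_le_of_ne (not_lt.1 h2) (hx _).symm, h1⟩
  · obtain ⟨k, h1, h2⟩ := Fin.exists_not_add_one (fun k ↦ (P.vertex k).1 < x) hi hj.not_gt
    exact ⟨k, h1, lt_of_le_of_ne (not_lt.1 h2) (hx _)⟩

/-- The derivative in `x` of the area of the part of the polygon to the left of `x`. -/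
noncomputable def areaRate (x : ℝ) : ℝ := ∑ i, edgeRate (P.vertex i) (P.vertex (i + 1)) x

theorem slice_eq_Icc {k l : Fin n} (hk : P.IsUpper k x) (hl : P.IsLower l x) :
    {y | (x, y) ∈ P.region} = Icc (P.height l x) (P.height k x) := by
  ext y
  refine ⟨fun h ↦ ⟨hl.height_le h.1, hk.le_height h.1⟩, fun h ↦ ⟨?_, ?_⟩⟩
  · have hc : Convex ℝ {y | (x, y) ∈ convexHull ℝ (range P.vertex)} := by
      intro a ha b hb s t hs ht hst
      have := convex_convexHull ℝ (range P.vertex) ha hb hs ht hst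
      have he : s * x + t * x = x := by rw [← add_mul, hst, one_mul]
      simpa [he] using this
    exact hc.ordConnected.out (show (x, P.height l x) ∈ _ from height_mem (Or.inl hl))
      (show (x, P.height k x) ∈ _ from height_mem (Or.inr hk)) h
  · have h1 := height_mem_kleinDisk (Or.inl hl)
    have h2 := height_mem_kleinDisk (Or.inr hk)
    change x ^ 2 + y ^ 2 < 1
    rcases le_total 0 y with h0 | h0
    · nlinarith [h.2]
    · nlinarith [h.1]

theorem areaRate_eq {k l : Fin n} (hk : P.IsUpper k x) (hl : P.IsLower l x) :
    P.areaRate x = slicePrimitive x (P.height k x) - slicePrimitive x (P.height l x) := by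
  have hkl : k ≠ l := by rintro rfl; exact hk.not_isLower hl
  rw [areaRate, Fintype.sum_eq_add k l hkl, sub_eq_add_neg]
  · exact congrArg₂ _ (if_pos hk)
      ((if_neg fun h ↦ IsUpper.not_isLower (P := P) h hl).trans (if_pos hl))
  · rintro i ⟨h1, h2⟩
    exact (if_neg fun h ↦ h1 (IsUpper.unique (P := P) h hk)).trans
      (if_neg fun h ↦ h2 (IsLower.unique (P := P) h hl))

theorem lintegral_slice_region (hx : ∀ i, x ≠ (P.vertex i).1) :
    (∫⁻ y in {y | (x, y) ∈ P.region}, ENNReal.ofReal (((1 - x ^ 2 - y ^ 2) ^ (3 / 2 : ℝ))⁻¹)) =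
      ENNReal.ofReal (P.areaRate x) ∧ 0 ≤ P.areaRate x := by
  by_cases h1 : ∃ i, (P.vertex i).1 < x
  · by_cases h2 : ∃ j, x < (P.vertex j).1
    · obtain ⟨i, hi⟩ := h1
      obtain ⟨j, hj⟩ := h2
      obtain ⟨⟨k, hk⟩, l, hl⟩ := P.exists_crossing hx hi hj
      have hle := hl.height_le (height_mem (Or.inr hk))
      have d1 := height_mem_kleinDisk (Or.inl hl)
      have d2 := height_mem_kleinDisk (Or.inr hk)
      rw [P.slice_eq_Icc hk hl, lintegral_slice hle d1 d2, P.areaRate_eq hk hl]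
      refine ⟨rfl, sub_nonneg.2 ?_⟩
      have hmono : MonotoneOn (slicePrimitive x) (Icc (P.height l x) (P.height k x)) := by
        have hin : ∀ y ∈ Icc (P.height l x) (P.height k x), x ^ 2 + y ^ 2 < 1 := by
          intro y h
          rw [← P.slice_eq_Icc hk hl] at h
          exact h.2
        refine monotoneOn_of_deriv_nonneg (convex_Icc _ _)
          (fun y hy ↦ (hasDerivAt_slicePrimitive (hin y hy)).continuousAt.continuousWithinAt)
          (fun y hy ↦ (hasDerivAt_slicePrimitive
            (hin y (interior_subset hy))).differentiableAt.differentiableWithinAt) fun y hy ↦ ?_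
        have := hin y (interior_subset hy)
        rw [(hasDerivAt_slicePrimitive this).deriv]
        exact inv_nonneg.2 (Real.rpow_nonneg (by linarith) _)
      exact hmono ⟨le_rfl, hle⟩ ⟨hle, le_rfl⟩ hle
    · push Not at h2
      have h2' : ∀ j, (P.vertex j).1 < x := fun j ↦ lt_of_le_of_ne (h2 j) (hx j).symm
      have hr : P.areaRate x = 0 := Finset.sum_eq_zero fun i _ ↦ by
        rw [edgeRate, if_neg fun h ↦ (h2' i).not_gt h.2, if_neg fun h ↦ (h2' _).not_gt h.2]
      have he : {y | (x, y) ∈ P.region} = ∅ := by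
        refine eq_empty_of_forall_notMem fun y hy ↦ ?_
        have := convexHull_min (t := {p : ℝ × ℝ | p.1 < x}) (by rintro _ ⟨j, rfl⟩; exact h2' j)
          (convex_halfSpace_lt (LinearMap.fst ℝ ℝ ℝ).isLinear x) hy.1
        exact lt_irrefl x this
      simp [hr, he]
  · push Not at h1
    have h1' : ∀ j, x < (P.vertex j).1 := fun j ↦ lt_of_le_of_ne (h1 j) (hx j)
    have hr : P.areaRate x = 0 := Finset.sum_eq_zero fun i _ ↦ by
      rw [edgeRate, if_neg fun h ↦ (h1' _).not_gt h.1, if_neg fun h ↦ (h1' _).not_gt h.1]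
    have he : {y | (x, y) ∈ P.region} = ∅ := by
      refine eq_empty_of_forall_notMem fun y hy ↦ ?_
      have := convexHull_min (t := {p : ℝ × ℝ | x < p.1}) (by rintro _ ⟨j, rfl⟩; exact h1' j)
        (convex_halfSpace_gt (LinearMap.fst ℝ ℝ ℝ).isLinear x) hy.1
      exact lt_irrefl x this
    simp [hr, he]

/-! ### The area as a sum over the sides -/

theorem measurableSet_kleinDisk : MeasurableSet kleinDisk :=
  (isOpen_lt (by fun_prop) (by fun_prop)).measurableSet

theorem measurableSet_region : MeasurableSet P.region :=
  (finite_range P.vertex).isClosed_convexHull ℝ |>.measurableSet.inter measurableSet_kleinDisk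

theorem hyperbolicArea_region :
    hyperbolicArea P.region = ENNReal.ofReal (∑ i,
      (edgeAngle (P.vertex i) (P.vertex (i + 1)) (P.vertex i).1 -
        edgeAngle (P.vertex i) (P.vertex (i + 1)) (P.vertex (i + 1)).1)) := by
  set f : ℝ × ℝ → ENNReal := fun p ↦
    ENNReal.ofReal (((1 - p.1 ^ 2 - p.2 ^ 2) ^ (3 / 2 : ℝ))⁻¹) with hf
  have hfm : Measurable f := by fun_prop
  have hR := P.measurableSet_region
  have hsub : P.region ⊆ kleinDisk := inter_subset_right
  set S : Finset ℝ := Finset.univ.image fun i ↦ (P.vertex i).1 with hS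
  have hxS : ∀ {x}, x ∉ S → ∀ i, x ≠ (P.vertex i).1 := by
    intro x hx i e
    exact hx (by rw [hS, e]; exact Finset.mem_image_of_mem _ (Finset.mem_univ i))
  -- Fubini: integrate over vertical slices. Those over the abscissae of the vertices, collected in
  -- `S`, form a null set.
  rw [hyperbolicArea, withDensity_apply _ hR, Measure.restrict_restrict hR,
    inter_eq_self_of_subset_left hsub, ← lintegral_indicator hR, Measure.volume_eq_prod,
    lintegral_prod _ (hfm.indicator hR).aemeasurable]
  have hin : ∀ x, ∫⁻ y, P.region.indicator f (x, y) =
      ∫⁻ y in {y | (x, y) ∈ P.region}, f (x, y) := by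
    intro x
    rw [← lintegral_indicator (show MeasurableSet {y | (x, y) ∈ P.region} from
      measurable_prodMk_left hR)]
    rfl
  have hout : ∀ x, x ∉ Ioo (-1 : ℝ) 1 → ∫⁻ y, P.region.indicator f (x, y) = 0 := by
    intro x hx
    have : ∀ y, (x, y) ∉ P.region := by
      intro y hy
      have h : x ^ 2 + y ^ 2 < 1 := hsub hy
      exact hx ⟨by nlinarith [sq_nonneg y], by nlinarith [sq_nonneg y]⟩
    simp [this]
  rw [← setLIntegral_eq_of_support_subset (s := Ioo (-1 : ℝ) 1)
    (fun x hx ↦ by by_contra h; exact hx (hout x h))]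
  rw [setLIntegral_congr_fun_ae measurableSet_Ioo
    (g := fun x ↦ ENNReal.ofReal (P.areaRate x)) ?_]
  · rw [lintegral_eq_sub_of_nonneg_off_finset S
      (fun x ↦ ∑ i, edgePrimitive (P.vertex i) (P.vertex (i + 1)) x) P.areaRate (by norm_num)]
    · rw [← Finset.sum_sub_distrib]
      simp_rw [edgePrimitive_one_sub (P.normSq_vertex_le _) (P.normSq_vertex_le _)]
    · exact (continuous_finsetSum _ fun i _ ↦ continuous_edgePrimitive (P.normSq_vertex_le _)
        (P.normSq_vertex_le _)).continuousOn
    · intro x _ hx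
      exact HasDerivAt.fun_sum fun i _ ↦ hasDerivAt_edgePrimitive (P.normSq_vertex_le _)
        (P.normSq_vertex_le _) (hxS hx _) (hxS hx _)
    · exact fun x _ hx ↦ (P.lintegral_slice_region (hxS hx)).2
  · filter_upwards [S.countable_toSet.ae_notMem volume] with x hx _
    rw [hin]
    exact (P.lintegral_slice_region (hxS hx)).1

end HyperbolicPolygon

/-! ### Jumps of the angle at the vertices -/

theorem edgeHeight_eq_of_orientation_eq_zero {p q r : ℝ × ℝ} (h : p.1 ≠ q.1)
    (hr : orientation p q r = 0) : edgeHeight p q r.1 = r.2 := by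
  have := orientation_eq_mul_sub_edgeHeight h r.1 r.2
  rw [Prod.mk.eta, hr, zero_eq_mul] at this
  rcases this with h' | h'
  · exact absurd (by linarith) h
  · linarith

theorem edgeAngle_of_mem_idealCircle {p q r : ℝ × ℝ} (hp : p.1 ^ 2 + p.2 ^ 2 ≤ 1)
    (hq : q.1 ^ 2 + q.2 ^ 2 ≤ 1) (hr : r ∈ idealCircle) (ho : orientation p q r = 0) :
    ∃ k : ℤ, edgeAngle p q r.1 = k * (Real.pi / 2) := by
  have hr : r.1 ^ 2 + r.2 ^ 2 = 1 := hr
  unfold edgeAngle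
  split_ifs with h
  · exact ⟨1, by simp⟩
  have hh := edgeHeight_eq_of_orientation_eq_zero h ho
  rw [edgeHeight] at hh
  have hc := normSq_edge_pos hp hq h
  rw [lineAngle]
  rcases eq_or_lt_of_le (show 0 ≤ 1 - r.1 ^ 2 by nlinarith [sq_nonneg r.2]) with hx | hx
  -- Here `r.1 = ±1`; the denominator is zero and the angle is `arcsin 0`.
  · exact ⟨0, by simp [← hx]⟩
  · have hs : ((edgeSlope p q + edgeIntercept p q * r.1) /
        (√(1 - r.1 ^ 2) * √(1 + edgeSlope p q ^ 2 - edgeIntercept p q ^ 2))) ^ 2 = 1 := by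
      rw [div_pow, mul_pow, Real.sq_sqrt hx.le, Real.sq_sqrt hc.le, normSq_line_mul, hh,
        show 1 - r.1 ^ 2 - r.2 ^ 2 = 0 by linarith, add_zero]
      apply div_self
      have := normSq_line_mul (edgeSlope p q) (edgeIntercept p q) r.1
      rw [hh, show 1 - r.1 ^ 2 - r.2 ^ 2 = 0 by linarith, add_zero] at this
      rw [← this]; positivity
    rcases mul_self_eq_one_iff.1 ((sq _).symm.trans hs) with h | h
    · exact ⟨1, by rw [h, Real.arcsin_one]; simp⟩
    · exact ⟨-1, by rw [h, Real.arcsin_neg_one]; simp⟩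

theorem lineNormal_zero (p q : ℝ × ℝ) : lineNormal p q 0 = -(q.2 - p.2) := rfl
theorem lineNormal_one (p q : ℝ × ℝ) : lineNormal p q 1 = q.1 - p.1 := rfl
theorem lineNormal_two (p q : ℝ × ℝ) : lineNormal p q 2 = -(p.1 * q.2 - p.2 * q.1) := rfl

/-- In terms of normals, vertical and non-vertical lines obey the same formulas. The sign `σ`
records the direction of the side, which `edgeAngle` forgets. -/
theorem sin_cos_edgeAngle {p q r : ℝ × ℝ} (hpq : p ≠ q) (hr : r ∈ kleinDisk)
    (ho : orientation p q r = 0) :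
    0 < lorentzInner (lineNormal p q) (lineNormal p q) ∧ ∃ σ : ℝ, σ ^ 2 = 1 ∧
      Real.sin (edgeAngle p q r.1) * (√(1 - r.1 ^ 2) *
        √(lorentzInner (lineNormal p q) (lineNormal p q))) =
        σ * -(lineNormal p q 0 - r.1 * lineNormal p q 2) ∧
      Real.cos (edgeAngle p q r.1) * (√(1 - r.1 ^ 2) *
        √(lorentzInner (lineNormal p q) (lineNormal p q))) =
        σ * (lineNormal p q 1 * √(1 - r.1 ^ 2 - r.2 ^ 2)) := by
  have hr : r.1 ^ 2 + r.2 ^ 2 < 1 := hr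
  have hx : 0 < 1 - r.1 ^ 2 := by nlinarith [sq_nonneg r.2]
  have hS : 0 < √(1 - r.1 ^ 2) := Real.sqrt_pos.2 hx
  have hSS := Real.mul_self_sqrt hx.le
  rw [lineNormal_zero, lineNormal_one, lineNormal_two]
  by_cases h : p.1 = q.1
  · have hy : q.2 - p.2 ≠ 0 := fun e ↦ hpq (Prod.ext h (by linarith))
    have hrx : r.1 = p.1 := by
      rw [orientation, h, sub_self, zero_mul, zero_sub, neg_eq_zero] at ho
      rcases mul_eq_zero.1 ho with e | e
      · exact absurd e hy
      · rw [h]; linarith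
    have hN : lorentzInner (lineNormal p q) (lineNormal p q) = (q.2 - p.2) ^ 2 * (1 - r.1 ^ 2) := by
      simp only [lorentzInner, lineNormal_zero, lineNormal_one, lineNormal_two, hrx, ← h]; ring
    rw [hN, Real.sqrt_mul (sq_nonneg _), Real.sqrt_sq_eq_abs, edgeAngle, if_pos h, Real.sin_pi_div_two,
      Real.cos_pi_div_two, ← h, hrx]
    rw [hrx] at hx hSS
    refine ⟨mul_pos (by positivity) hx, |q.2 - p.2| / (q.2 - p.2), ?_, ?_, ?_⟩
    · rw [div_pow, sq_abs, div_self (by positivity)]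
    · field_simp
      linear_combination hSS
    · simp
  · have hd : q.1 - p.1 ≠ 0 := sub_ne_zero.2 (Ne.symm h)
    have hh := edgeHeight_eq_of_orientation_eq_zero h ho
    rw [edgeHeight] at hh
    have hin : r.1 ^ 2 + (edgeSlope p q * r.1 + edgeIntercept p q) ^ 2 < 1 := by rwa [hh]
    have hC := Real.sqrt_pos.2 (normSq_line_pos hin)
    have e0 : q.2 - p.2 = (q.1 - p.1) * edgeSlope p q := by rw [edgeSlope]; field_simp
    have e2 : -(p.1 * q.2 - p.2 * q.1) = (q.1 - p.1) * edgeIntercept p q := by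
      rw [edgeIntercept, edgeSlope]; field_simp; ring
    have hN : lorentzInner (lineNormal p q) (lineNormal p q) =
        (q.1 - p.1) ^ 2 * (1 + edgeSlope p q ^ 2 - edgeIntercept p q ^ 2) := by
      simp only [lorentzInner, lineNormal_zero, lineNormal_one, lineNormal_two, e0, e2]; ring
    rw [hN, Real.sqrt_mul (sq_nonneg _), Real.sqrt_sq_eq_abs, edgeAngle, if_neg h, e0, e2,
      sin_lineAngle hin, cos_lineAngle hin, hh]
    refine ⟨mul_pos (by positivity) (normSq_line_pos hin), |q.1 - p.1| / (q.1 - p.1), ?_, ?_, ?_⟩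
    · rw [div_pow, sq_abs, div_self (by positivity)]
    · field_simp; ring
    · field_simp

/-- The difference of the angles of two lines through `r` is, up to sign and modulo `π`, the
Lorentzian angle between their normals. -/
theorem cos_edgeAngle_sub {p q p' q' r : ℝ × ℝ} (hpq : p ≠ q) (hpq' : p' ≠ q') (hr : r ∈ kleinDisk)
    (ho : orientation p q r = 0) (ho' : orientation p' q' r = 0) :
    ∃ σ : ℝ, σ ^ 2 = 1 ∧ Real.cos (edgeAngle p' q' r.1 - edgeAngle p q r.1) =
      σ * (-lorentzInner (lineNormal p q) (lineNormal p' q') /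
        (√(lorentzInner (lineNormal p q) (lineNormal p q)) *
          √(lorentzInner (lineNormal p' q') (lineNormal p' q')))) := by
  obtain ⟨hN, σ, hσ, hs, hc⟩ := sin_cos_edgeAngle hpq hr ho
  obtain ⟨hN', σ', hσ', hs', hc'⟩ := sin_cos_edgeAngle hpq' hr ho'
  have hr : r.1 ^ 2 + r.2 ^ 2 < 1 := hr
  have hx : 0 < 1 - r.1 ^ 2 := by nlinarith [sq_nonneg r.2]
  have hS : 0 < √(1 - r.1 ^ 2) := Real.sqrt_pos.2 hx
  have hSS := Real.mul_self_sqrt hx.le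
  have hRR := Real.mul_self_sqrt (show 0 ≤ 1 - r.1 ^ 2 - r.2 ^ 2 by linarith)
  rw [← lorentzInner_lineNormal] at ho ho'
  have ho : lineNormal p q 0 * r.1 + lineNormal p q 1 * r.2 - lineNormal p q 2 = 0 := by
    simpa [lorentzInner] using ho
  have ho' : lineNormal p' q' 0 * r.1 + lineNormal p' q' 1 * r.2 - lineNormal p' q' 2 = 0 := by
    simpa [lorentzInner] using ho'
  have hM := Real.sqrt_pos.2 hN
  have hM' := Real.sqrt_pos.2 hN'
  refine ⟨-(σ * σ'), by rw [neg_sq, mul_pow, hσ, hσ', one_mul], ?_⟩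
  rw [Real.cos_sub, ← mul_div_assoc, eq_div_iff (mul_pos hM hM').ne']
  apply mul_right_cancel₀ hx.ne'
  set M := √(lorentzInner (lineNormal p q) (lineNormal p q))
  set M' := √(lorentzInner (lineNormal p' q') (lineNormal p' q'))
  set S := √(1 - r.1 ^ 2)
  set R := √(1 - r.1 ^ 2 - r.2 ^ 2)
  simp only [lorentzInner]
  generalize Real.cos (edgeAngle p' q' r.1) = c' at *
  generalize Real.cos (edgeAngle p q r.1) = c at *
  generalize Real.sin (edgeAngle p' q' r.1) = s' at *
  generalize Real.sin (edgeAngle p q r.1) = s at *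
  generalize lineNormal p q 0 = a0 at *
  generalize lineNormal p q 1 = a1 at *
  generalize lineNormal p q 2 = a2 at *
  generalize lineNormal p' q' 0 = b0 at *
  generalize lineNormal p' q' 1 = b1 at *
  generalize lineNormal p' q' 2 = b2 at *
  -- Both normals are orthogonal to `r`, which determines their last coordinates; a polynomial
  -- identity remains.
  obtain rfl : a2 = a0 * r.1 + a1 * r.2 := by linarith
  obtain rfl : b2 = b0 * r.1 + b1 * r.2 := by linarith
  have e1 : (c' * (S * M')) * (c * (S * M)) = (σ' * (b1 * R)) * (σ * (a1 * R)) := by rw [hc, hc']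
  have e2 : (s' * (S * M')) * (s * (S * M)) =
      (σ' * -(b0 - r.1 * (b0 * r.1 + b1 * r.2))) * (σ * -(a0 - r.1 * (a0 * r.1 + a1 * r.2))) := by
    rw [hs, hs']
  rw [← hSS]
  linear_combination e1 + e2 + (σ * σ' * a1 * b1) * hRR +
    σ * σ' * (a0 * b0 + a1 * b1 - (a0 * r.1 + a1 * r.2) * (b0 * r.1 + b1 * r.2)) * (-hSS)

theorem edgeAngle_sub_of_dihedralAngle {p q r : ℝ × ℝ} (hpq : p ≠ q) (hqr : q ≠ r)
    (hq : q ∈ kleinDisk) (h : dihedralAngle p q r = 0 ∨ dihedralAngle p q r = Real.pi / 2) :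
    ∃ k : ℤ, edgeAngle q r q.1 - edgeAngle p q q.1 = k * (Real.pi / 2) := by
  obtain ⟨σ, hσ, hc⟩ := cos_edgeAngle_sub hpq hqr hq
    (show orientation p q q = 0 by simp only [orientation]; ring)
    (show orientation q r q = 0 by simp [orientation])
  unfold dihedralAngle at h
  set z := -lorentzInner (lineNormal p q) (lineNormal q r) /
    (√(lorentzInner (lineNormal p q) (lineNormal p q)) *
      √(lorentzInner (lineNormal q r) (lineNormal q r)))
  set d := edgeAngle q r q.1 - edgeAngle p q q.1
  have hd := Real.sin_sq_add_cos_sq d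
  rcases h with h | h
  -- The value `0` at an actual vertex need not be excluded: it means `1 ≤ z`, so `sin d = 0` and
  -- `d` is a multiple of `π`.
  · rw [Real.arccos_eq_zero] at h
    have : Real.cos d ^ 2 = z ^ 2 := by rw [hc, mul_pow, hσ, one_mul]
    have hs : Real.sin d = 0 := by nlinarith [sq_nonneg (Real.sin d)]
    obtain ⟨k, hk⟩ := Real.sin_eq_zero_iff.1 hs
    exact ⟨2 * k, by rw [← hk]; push_cast; ring⟩
  · rw [Real.arccos_eq_pi_div_two] at h
    rw [h, mul_zero] at hc
    obtain ⟨k, hk⟩ := Real.cos_eq_zero_iff.1 hc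
    exact ⟨2 * k + 1, by rw [hk]; push_cast; ring⟩

/-! ### Integrality and positivity of the area -/

theorem Convex.combo₃_mem {E : Type*} [AddCommGroup E] [Module ℝ E] {K : Set E} (hK : Convex ℝ K)
    {a b c : E} (ha : a ∈ K) (hb : b ∈ K) (hc : c ∈ K) {s t u : ℝ} (hs : 0 ≤ s) (ht : 0 ≤ t)
    (hu : 0 ≤ u) (h : s + t + u = 1) : s • a + t • b + u • c ∈ K := by
  have := hK.sum_mem (t := Finset.univ) (w := ![s, t, u]) (z := ![a, b, c])
    (by intro i _; fin_cases i <;> assumption) (by simpa [Fin.sum_univ_three] using h)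
    (by intro i _; fin_cases i <;> assumption)
  simpa [Fin.sum_univ_three] using this

namespace HyperbolicPolygon

variable {n : ℕ} [NeZero n] (P : HyperbolicPolygon n)

variable {P} in
theorem IsRightAngled.exists_edgeAngle_sub (h : P.IsRightAngled) (i : Fin n) :
    ∃ k : ℤ, edgeAngle (P.vertex i) (P.vertex (i + 1)) (P.vertex i).1 -
      edgeAngle (P.vertex (i - 1)) (P.vertex i) (P.vertex i).1 = k * (Real.pi / 2) := by
  have hne := P.vertex_ne (i - 1)
  rw [sub_add_cancel] at hne
  rcases P.vertex_mem i with hi | hi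
  · exact edgeAngle_sub_of_dihedralAngle hne (P.vertex_ne i) hi (h i)
  · obtain ⟨k, hk⟩ := edgeAngle_of_mem_idealCircle (P.normSq_vertex_le i)
      (P.normSq_vertex_le (i + 1)) hi (by simp [orientation])
    obtain ⟨l, hl⟩ := edgeAngle_of_mem_idealCircle (P.normSq_vertex_le (i - 1))
      (P.normSq_vertex_le i) hi (by simp only [orientation]; ring)
    exact ⟨k - l, by rw [hk, hl]; push_cast; ring⟩

/-- The area of a right-angled polygon is an integral multiple of `π / 2`. -/
theorem hyperbolicArea_eq_mul {P : HyperbolicPolygon n} (h : P.IsRightAngled) :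
    ∃ k : ℤ, hyperbolicArea P.region = ENNReal.ofReal (k * (Real.pi / 2)) := by
  choose k hk using h.exists_edgeAngle_sub
  refine ⟨∑ i, k i, ?_⟩
  rw [P.hyperbolicArea_region, Finset.sum_sub_distrib]
  -- A cyclic shift pairs the end of each side with the start of the next one.
  have hshift : ∑ i, edgeAngle (P.vertex i) (P.vertex (i + 1)) (P.vertex (i + 1)).1 =
      ∑ i, edgeAngle (P.vertex (i - 1)) (P.vertex i) (P.vertex i).1 := by
    rw [← Equiv.sum_comp (Equiv.addRight (1 : Fin n))
      fun i ↦ edgeAngle (P.vertex (i - 1)) (P.vertex i) (P.vertex i).1]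
    simp
  rw [hshift, ← Finset.sum_sub_distrib, Finset.sum_congr rfl fun i _ ↦ hk i, ← Finset.sum_mul]
  push_cast
  rfl

theorem hyperbolicArea_region_pos : 0 < hyperbolicArea P.region := by
  have hD := P.orientation_add_two_pos 0
  have hab := P.vertex_ne 0
  have ha := P.normSq_vertex_le 0
  have hb := P.normSq_vertex_le (0 + 1)
  have hc := P.normSq_vertex_le (0 + 1 + 1)
  have ma := subset_convexHull ℝ _ (mem_range_self (f := P.vertex) 0)
  have mb := subset_convexHull ℝ _ (mem_range_self (f := P.vertex) (0 + 1))
  have mc := subset_convexHull ℝ _ (mem_range_self (f := P.vertex) (0 + 1 + 1))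
  generalize P.vertex 0 = a at *
  generalize P.vertex (0 + 1) = b at *
  generalize P.vertex (0 + 1 + 1) = c at *
  let U : Set (ℝ × ℝ) := {p | 0 < orientation a b p} ∩ {p | 0 < orientation b c p} ∩
    {p | 0 < orientation c a p} ∩ kleinDisk
  -- `U` is the open triangle on three consecutive vertices, cut with the disk. It contains their
  -- centroid, which is in the open disk because `a ≠ b`.
  have hU : IsOpen U := by
    have ho : ∀ p q : ℝ × ℝ, IsOpen {r | 0 < orientation p q r} := fun p q ↦
      isOpen_lt continuous_const (by unfold orientation; fun_prop)
    exact (((ho _ _).inter (ho _ _)).inter (ho _ _)).inter (isOpen_lt (by fun_prop) (by fun_prop))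
  have hne : U.Nonempty := by
    refine ⟨((a.1 + b.1 + c.1) / 3, (a.2 + b.2 + c.2) / 3), ⟨⟨?_, ?_⟩, ?_⟩, ?_⟩
    · simp only [orientation, mem_ofPred_eq] at hD ⊢; nlinarith
    · simp only [orientation, mem_ofPred_eq] at hD ⊢; nlinarith
    · simp only [orientation, mem_ofPred_eq] at hD ⊢; nlinarith
    · have h0 : 0 < (a.1 - b.1) ^ 2 + (a.2 - b.2) ^ 2 := by
        by_contra hn
        apply hab
        ext <;> nlinarith [sq_nonneg (a.1 - b.1), sq_nonneg (a.2 - b.2)]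
      change ((a.1 + b.1 + c.1) / 3) ^ 2 + ((a.2 + b.2 + c.2) / 3) ^ 2 < 1
      nlinarith [sq_nonneg (a.1 - c.1), sq_nonneg (a.2 - c.2), sq_nonneg (b.1 - c.1),
        sq_nonneg (b.2 - c.2)]
  have hsub : U ⊆ P.region := by
    rintro p ⟨⟨⟨h1, h2⟩, h3⟩, h4⟩
    refine ⟨?_, h4⟩
    have hsum : orientation b c p + orientation c a p + orientation a b p = orientation a b c := by
      simp only [orientation]; ring
    -- Barycentric coordinates are ratios of oriented areas.
    have hp : p = (orientation b c p / orientation a b c) • a +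
        ((orientation c a p / orientation a b c) • b +
          (orientation a b p / orientation a b c) • c) := by
      have := hD.ne'
      ext
      · simp only [Prod.fst_add, Prod.smul_fst, smul_eq_mul]
        field_simp
        simp only [orientation]; ring
      · simp only [Prod.snd_add, Prod.smul_snd, smul_eq_mul]
        field_simp
        simp only [orientation]; ring
    rw [hp, ← add_assoc]
    exact (convex_convexHull ℝ (range P.vertex)).combo₃_mem ma mb mc (div_pos h2 hD).le
      (div_pos h3 hD).le (div_pos h1 hD).le (by rw [← add_div, ← add_div, hsum, div_self hD.ne'])
  refine lt_of_lt_of_le ?_ (measure_mono hsub)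
  have hUD : U ⊆ kleinDisk := inter_subset_right
  rw [hyperbolicArea, withDensity_apply _ hU.measurableSet,
    Measure.restrict_restrict hU.measurableSet, inter_eq_self_of_subset_left hUD]
  rw [setLIntegral_pos_iff (by fun_prop)]
  refine lt_of_lt_of_le (hU.measure_pos volume hne) (measure_mono fun p hp ↦ ⟨?_, hp⟩)
  have : p.1 ^ 2 + p.2 ^ 2 < 1 := hUD hp
  rw [Function.mem_support, ENNReal.ofReal_ne_zero_iff]
  exact inv_pos.2 (Real.rpow_pos_of_pos (by linarith) _)

theorem pi_div_two_le_hyperbolicArea {P : HyperbolicPolygon n} (h : P.IsRightAngled) :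
    ENNReal.ofReal (Real.pi / 2) ≤ hyperbolicArea P.region := by
  obtain ⟨k, hk⟩ := hyperbolicArea_eq_mul h
  have hpos := P.hyperbolicArea_region_pos
  rw [hk, ENNReal.ofReal_pos] at hpos
  rw [hk]
  apply ENNReal.ofReal_le_ofReal
  have hk0 : (0 : ℝ) < k := pos_of_mul_pos_left hpos (by positivity)
  have hk1 : (1 : ℝ) ≤ k := by exact_mod_cast Int.cast_pos.1 hk0
  nlinarith [Real.pi_pos]

end HyperbolicPolygon

/-! ### The triangle `P²` -/

/-- The triangle with vertices `(0, 0)`, `(1, 0)`, `(0, 1)`. -/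
def rightTriangle : HyperbolicPolygon 3 where
  three_le := le_rfl
  vertex := ![(0, 0), (1, 0), (0, 1)]
  vertex_mem i := by fin_cases i <;> simp [kleinDisk, idealCircle]
  left_of_side i j := by fin_cases i <;> fin_cases j <;> simp [orientation]

theorem rightTriangle_region_eq :
    rightTriangle.region = {p | 0 ≤ p.1 ∧ 0 ≤ p.2 ∧ p.1 + p.2 ≤ 1} ∩ kleinDisk := by
  rw [HyperbolicPolygon.region]
  congr 1
  apply subset_antisymm
  · apply convexHull_min
    · rintro _ ⟨i, rfl⟩
      fin_cases i <;> simp [rightTriangle]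
    · rintro a ⟨h1, h2, h3⟩ b ⟨h4, h5, h6⟩ s t hs ht hst
      refine ⟨add_nonneg (mul_nonneg hs h1) (mul_nonneg ht h4),
        add_nonneg (mul_nonneg hs h2) (mul_nonneg ht h5), ?_⟩
      simp only [Prod.fst_add, Prod.smul_fst, smul_eq_mul, Prod.snd_add, Prod.smul_snd]
      linarith [mul_le_mul_of_nonneg_left h3 hs, mul_le_mul_of_nonneg_left h6 ht]
  · rintro p ⟨h1, h2, h3⟩
    have := (convex_convexHull ℝ (range rightTriangle.vertex)).combo₃_mem
      (subset_convexHull ℝ _ (mem_range_self 0)) (subset_convexHull ℝ _ (mem_range_self 1))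
      (subset_convexHull ℝ _ (mem_range_self 2)) (sub_nonneg.2 h3) h1 h2 (by ring)
    convert this using 1
    ext <;> simp [rightTriangle]

theorem triangleDelta_eq :
    triangleDelta = {p | 0 ≤ p.2 ∧ p.2 ≤ p.1 ∧ p.1 + p.2 ≤ 1} ∩ kleinDisk := by
  rw [triangleDelta]
  congr 1
  apply subset_antisymm
  · apply convexHull_min
    · rintro _ (rfl | rfl | rfl) <;> norm_num
    · rintro a ⟨h1, h2, h3⟩ b ⟨h4, h5, h6⟩ s t hs ht hst
      refine ⟨add_nonneg (mul_nonneg hs h1) (mul_nonneg ht h4),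
        add_le_add (mul_le_mul_of_nonneg_left h2 hs) (mul_le_mul_of_nonneg_left h5 ht), ?_⟩
      simp only [Prod.fst_add, Prod.smul_fst, smul_eq_mul, Prod.snd_add, Prod.smul_snd]
      linarith [mul_le_mul_of_nonneg_left h3 hs, mul_le_mul_of_nonneg_left h6 ht]
  · rintro p ⟨h1, h2, h3⟩
    -- The barycentric coordinates of `(x, y)` are `x - y`, `2 y` and `1 - x - y`.
    have := (convex_convexHull ℝ {((1, 0) : ℝ × ℝ), (1 / 2, 1 / 2), (0, 0)}).combo₃_mem
      (subset_convexHull ℝ _ (Or.inl rfl)) (subset_convexHull ℝ _ (Or.inr (Or.inl rfl)))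
      (subset_convexHull ℝ _ (Or.inr (Or.inr rfl))) (sub_nonneg.2 h2)
      (mul_nonneg zero_le_two h1) (sub_nonneg.2 h3) (by ring)
    convert this using 1
    ext <;> simp <;> ring

theorem rightTriangle_region : rightTriangle.region = polygonP2 := by
  rw [rightTriangle_region_eq, polygonP2, triangleDelta_eq, image_swap_eq_preimage_swap]
  ext p
  simp only [mem_inter_iff, mem_union, mem_preimage, mem_ofPred_eq, kleinDisk, Prod.fst_swap,
    Prod.snd_swap]
  rw [add_comm p.2 p.1, add_comm (p.2 ^ 2)]
  rcases le_total p.1 p.2 with h | h <;> grind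

theorem isRightAngled_rightTriangle : rightTriangle.IsRightAngled := by
  intro i
  fin_cases i <;>
    simp [HyperbolicPolygon.angle, dihedralAngle, rightTriangle, lorentzInner, lineNormal]

theorem hyperbolicArea_polygonP2 :
    hyperbolicArea polygonP2 = ENNReal.ofReal (Real.pi / 2) := by
  rw [← rightTriangle_region, rightTriangle.hyperbolicArea_region, Fin.sum_univ_three]
  -- Only the side from `(1, 0)` to `(0, 1)` contributes: its angle is `0` at the start and `-π / 2`
  -- at the end.
  simp [rightTriangle, edgeAngle, lineAngle, edgeSlope, edgeIntercept]

end

/-- `P²` is a right-angled triangle with one (actual) right angle and two ideal vertices, its area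
is `π / 2`, and no right-angled polygon in `H²` has smaller area. -/
theorem theorem3p2 :
    (∃ T : HyperbolicPolygon 3, T.region = polygonP2 ∧ T.IsRightAngled ∧
      T.vertex 0 ∈ kleinDisk ∧ T.angle 0 = Real.pi / 2 ∧
      T.vertex 1 ∈ idealCircle ∧ T.vertex 2 ∈ idealCircle) ∧
    hyperbolicArea polygonP2 = ENNReal.ofReal (Real.pi / 2) ∧
    ∀ (n : ℕ) [NeZero n] (Q : HyperbolicPolygon n), Q.IsRightAngled →
      hyperbolicArea polygonP2 ≤ hyperbolicArea Q.region := by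
  refine ⟨⟨rightTriangle, rightTriangle_region, isRightAngled_rightTriangle, ?_, ?_, ?_, ?_⟩,
    hyperbolicArea_polygonP2, fun n _ Q hQ ↦ ?_⟩
  · simp [rightTriangle, kleinDisk]
  · simp [HyperbolicPolygon.angle, dihedralAngle, rightTriangle, lorentzInner, lineNormal]
  · simp [rightTriangle, idealCircle]
  · simp [rightTriangle, idealCircle]
  · rw [hyperbolicArea_polygonP2]
    exact HyperbolicPolygon.pi_div_two_le_hyperbolicArea hQ
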